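/- A permutation $\pi$ of $\{1,\dots,n\}$ is called alternating if $\pi(1)<\pi(2)>\pi(3)<\pi(4)>\cdots$. Let $\mathfrak{A}_n(2413,3142)$ be the set of alternating permutations of $\{1,\dots,n\}$ that avoid both patterns $2413$ and $3142$, i.e. that have no subsequence $\pi(i_1)\pi(i_2)\pi(i_3)\pi(i_4)$ with $i_1<i_2<i_3<i_4$ which is order-isomorphic to $2413$ or to $3142$. For $n\ge 1$ put $$r_n:=|\mathfrak{A}_{2n+1}(2413,3142)|,\qquad t_n:=|\mathfrak{A}_{2n}(2413,3142)|,$$ and let $R(x):=\sum_{n\ge 1} r_n x^n$ and $T(x):=\sum_{n\ge 1} t_n x^n$ as formal power series. Then $$\tfrac12 R(x)=\tfrac12 R(x)\cdot T(x)+T(x).$$ Consequently, $t_1=1$ and, for all $n\ge 2$, $$t_n=\frac{4}{n-1}\sum_{i=0}^{n-2}2^i\binom{2n-1}{i}\binom{n-1}{i+1}.$$ -/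

import Mathlib

/-- The permutation `π` of length `n` contains the pattern `p` of length `k`: some subsequence
`π(i₁) ⋯ π(iₖ)` with `i₁ < ⋯ < iₖ` is order-isomorphic to `p`. -/
def ContainsPattern {n k : ℕ} (π : Equiv.Perm (Fin n)) (p : Equiv.Perm (Fin k)) : Prop :=
  ∃ f : Fin k → Fin n, StrictMono f ∧ ∀ a b : Fin k, π (f a) < π (f b) ↔ p a < p b

/-- Alternating (up-down) permutations: `π(1) < π(2) > π(3) < ⋯`. Positions are numbered from `0`
here, so there is an ascent at every even position and a descent at every odd one. -/
def IsAlternatingPerm {n : ℕ} (π : Equiv.Perm (Fin n)) : Prop :=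
  ∀ i j : Fin n, (j : ℕ) = (i : ℕ) + 1 →
    (Even (i : ℕ) → π i < π j) ∧ (Odd (i : ℕ) → π j < π i)

/-- The pattern `2413`, with positions and values numbered from `0`. -/
def pattern2413 : Equiv.Perm (Fin 4) where
  toFun := ![1, 3, 0, 2]
  invFun := ![2, 0, 3, 1]
  left_inv := by decide
  right_inv := by decide

/-- The pattern `3142`, with positions and values numbered from `0`. -/
def pattern3142 : Equiv.Perm (Fin 4) where
  toFun := ![2, 0, 3, 1]
  invFun := ![1, 3, 0, 2]
  left_inv := by decide
  right_inv := by decide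

/-- The set of alternating permutations of length `n` that avoid both `2413` and `3142`. -/
def separableAlternating (n : ℕ) : Set (Equiv.Perm (Fin n)) :=
  {π | IsAlternatingPerm π ∧
    ¬ ContainsPattern π pattern2413 ∧ ¬ ContainsPattern π pattern3142}

/-- `r n` is the number of such permutations of length `2n + 1`. -/
noncomputable def rCount (n : ℕ) : ℕ := (separableAlternating (2 * n + 1)).ncard

/-- `t n` is the number of such permutations of length `2n`. -/
noncomputable def tCount (n : ℕ) : ℕ := (separableAlternating (2 * n)).ncard

/-- `R(x) = ∑_{n ≥ 1} r n xⁿ`; the sum starts at `n = 1`. -/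
noncomputable def seriesR : PowerSeries ℚ :=
  PowerSeries.mk fun n => if n = 0 then 0 else (rCount n : ℚ)

/-- `T(x) = ∑_{n ≥ 1} t n xⁿ`; the sum starts at `n = 1`. -/
noncomputable def seriesT : PowerSeries ℚ :=
  PowerSeries.mk fun n => if n = 0 then 0 else (tCount n : ℚ)

/-! A permutation of length at least 2 avoiding 2413 and 3142 is a direct sum or the complement of
one, never both (`splitsUp_or_splitsUp_neg`, `SplitsUp.not_neg`). Let a count the alternating ones,
and i₀, i₁ the sum-indecomposable ones that start with an ascent, respectively a descent. The step
between two summands ascends, which fixes the parity of the length of the first component; by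
complementation the remainder is counted by a whatever its first step
(`ncard_separableAlternating_eq`). Complementation also gives i₀ + i₁ = a, except at length 1
(`ncard_indecomposableFrom_add`). Eliminating i₀ and i₁ leaves O - X = T(O + X) and T = O² for the
odd and even parts O, T of the series of a (`parity_system`). In terms of X² this reads R = 2T + RT
and T(1 - T)² = X(1 + T)², and Lagrange inversion with φ = ((1 + X)/(1 - X))² yields the
coefficients. -/

/-! ### Lagrange inversion and the explicit coefficients. -/

namespace PowerSeries

/-- The coefficient extraction behind Lagrange inversion: if `g * φ = X`, then the coefficient of
`X ^ N` in `(g ^ k)' φ ^ (N + 1)` is `N + 1` when `k = N + 1` and vanishes for other `k ≤ N + 1`. -/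
theorem coeff_derivative_pow_mul_pow {g φ : ℚ⟦X⟧} (hg : constantCoeff g = 0) (h : g * φ = X)
    {N k : ℕ} (hk : k ≤ N + 1) :
    coeff N (derivative ℚ (g ^ k) * φ ^ (N + 1)) = if k = N + 1 then (N + 1 : ℚ) else 0 := by
  have hd : derivative ℚ g * φ = 1 - g * derivative ℚ φ := by
    have := congrArg (derivative ℚ) h
    rw [Derivation.leibniz, derivative_X, smul_eq_mul, smul_eq_mul] at this
    linear_combination this
  obtain _ | k := k
  · simp
  have hdk : derivative ℚ (g ^ (k + 1)) = ((k + 1 : ℕ) : ℚ⟦X⟧) * g ^ k * derivative ℚ g := by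
    rw [derivative_pow, Nat.add_sub_cancel]
  obtain ⟨m, rfl⟩ : ∃ m, N = k + m := ⟨N - k, by omega⟩
  -- Each factor g cancels one φ into X, and φ g' = 1 - g φ' removes the derivative of g.
  have key : derivative ℚ (g ^ (k + 1)) * φ ^ (k + m + 1)
      = X ^ k * (((k + 1 : ℕ) : ℚ) • (φ ^ m * (1 - g * derivative ℚ φ))) := by
    rw [hdk, ← hd, ← h, smul_eq_C_mul, map_natCast]
    ring
  rw [key, add_comm k m, coeff_X_pow_mul, coeff_smul]
  obtain _ | m := m
  · simp [hg]
  -- Since gφ = X, the product is φ^(m+1) - X (φ^(m+1))' / (m+1), whose coefficient at X^(m+1)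
  -- cancels.
  · have h2 : coeff (m + 1) (φ ^ (m + 1) * (1 - g * derivative ℚ φ)) = 0 := by
      have e : φ ^ (m + 1) * (1 - g * derivative ℚ φ)
          = φ ^ (m + 1) - X * (φ ^ m * derivative ℚ φ) := by
        rw [← h]; ring
      have e2 : derivative ℚ (φ ^ (m + 1)) = ((m + 1 : ℕ) : ℚ) • (φ ^ m * derivative ℚ φ) := by
        rw [derivative_pow, Nat.add_sub_cancel, smul_eq_C_mul, map_natCast]
        ring
      have e3 := congrArg (coeff m) e2
      rw [coeff_derivative, coeff_smul, smul_eq_mul] at e3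
      have hm : ((m + 1 : ℕ) : ℚ) ≠ 0 := by positivity
      rw [e, map_sub, coeff_succ_X_mul, sub_eq_zero]
      apply mul_left_cancel₀ hm
      rw [← e3]
      push_cast
      ring
    rw [h2, smul_zero, if_neg (by omega)]

/-- Lagrange inversion: if `g * φ = X` and `T(g) = X`, then `n [Xⁿ] T = [Xⁿ⁻¹] φⁿ`. -/
theorem lagrange_inversion {g φ T : ℚ⟦X⟧} (hg : constantCoeff g = 0) (h : g * φ = X)
    (hT : T.subst g = X) (N : ℕ) :
    (N + 1 : ℚ) * coeff (N + 1) T = coeff N (φ ^ (N + 1)) := by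
  have hs : HasSubst g := HasSubst.of_constantCoeff_zero' hg
  -- Truncating T keeps the expansion of T(g) finite; the tail is a multiple of g^(N+2), and its
  -- derivative times φ^(N+1) is divisible by X^(N+1).
  obtain ⟨q, hq⟩ : (X : ℚ⟦X⟧) ^ (N + 2) ∣ T - (trunc (N + 2) T : Polynomial ℚ) := by
    rw [X_pow_dvd_iff]
    intro m hm
    rw [map_sub, coeff_coe_trunc_of_lt hm, sub_self]
  have hX : (X : ℚ⟦X⟧) = ∑ i ∈ Finset.range (N + 2), coeff i T • g ^ i
      + g ^ (N + 2) * q.subst g := by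
    conv_lhs => rw [← hT, sub_eq_iff_eq_add'.mp hq, subst_add hs, subst_mul hs, subst_pow hs,
      subst_X hs, subst_coe hs]
    congr 1
    rw [Polynomial.aeval_eq_sum_range' (natDegree_trunc_lt T (N + 1))]
    refine Finset.sum_congr rfl fun i hi => ?_
    rw [coeff_trunc, if_pos (Finset.mem_range.mp hi)]
  have htail : coeff N (derivative ℚ (g ^ (N + 2) * q.subst g) * φ ^ (N + 1)) = 0 := by
    have e : derivative ℚ (g ^ (N + 2) * q.subst g) * φ ^ (N + 1) = X ^ (N + 1) *
        (((N + 2 : ℕ) : ℚ⟦X⟧) * derivative ℚ g * q.subst g + g * derivative ℚ (q.subst g)) := by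
      rw [Derivation.leibniz, derivative_pow, smul_eq_mul, smul_eq_mul, ← h,
        show N + 2 - 1 = N + 1 from rfl]
      ring
    rw [e, coeff_X_pow_mul', if_neg (by omega)]
  have hL := congrArg (fun f => coeff N (derivative ℚ f * φ ^ (N + 1))) hX
  simp only [derivative_X, one_mul, map_add, add_mul, htail, add_zero, map_sum, Finset.sum_mul,
    Derivation.map_smul, smul_mul_assoc, coeff_smul] at hL
  rw [hL, Finset.sum_congr rfl fun i hi => by
    rw [coeff_derivative_pow_mul_pow hg h (by simpa [Nat.lt_succ_iff] using hi)]]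
  simp [mul_comm]

/-- The coefficients of `((1 + X) / (1 - X)) ^ (2 (m + 2))`. -/
theorem coeff_one_add_div_one_sub_pow {w : ℚ⟦X⟧} (hw : w * (1 - X) = 1 + X) (m : ℕ) :
    (m + 1 : ℚ) * coeff (m + 1) (w ^ (2 * (m + 2))) = 4 * (m + 2) *
      ∑ i ∈ Finset.range (m + 1),
        (2 : ℚ) ^ i * ((2 * (m + 2) - 1).choose i : ℚ) * ((m + 1).choose (i + 1) : ℚ) := by
  set v : ℚ⟦X⟧ := mk 1 with hv
  have hv1 : v * (1 - X) = 1 := mk_one_mul_one_sub_eq_one ℚ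
  have hwv : w = 1 + 2 * X * v := by
    linear_combination (-w + 1) * hv1 + v * hw
  have hdv : derivative ℚ v = v ^ 2 := by
    have := congrArg (derivative ℚ) hv1
    simp only [Derivation.leibniz, map_sub, derivative_X, derivative_one, smul_eq_mul] at this
    linear_combination v * this - derivative ℚ v * hv1
  have hdw : derivative ℚ w = 2 * v ^ 2 := by
    have hw2 : w = (2 : ℚ) • v - 1 := by
      rw [smul_eq_C_mul, map_ofNat]
      linear_combination hwv - 2 * hv1
    rw [hw2, map_sub, Derivation.map_smul, hdv, derivative_one, smul_eq_C_mul, map_ofNat, sub_zero]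
  -- Differentiating before the binomial expansion in 2Xv, with v = 1/(1 - X), produces the factor m
  -- + 1 on the left and 4(m + 2) on the right.
  have hd : derivative ℚ (w ^ (2 * (m + 2))) = (4 * (m + 2) : ℚ) •
      ∑ i ∈ Finset.range (2 * (m + 2)),
        ((2 : ℚ) ^ i * ((2 * (m + 2) - 1).choose i : ℚ)) • (X ^ i * v ^ (i + 1 + 1)) := by
    have e : w ^ (2 * (m + 2) - 1) * v ^ 2 = ∑ i ∈ Finset.range (2 * (m + 2)),
        ((2 : ℚ) ^ i * ((2 * (m + 2) - 1).choose i : ℚ)) • (X ^ i * v ^ (i + 1 + 1)) := by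
      rw [hwv, add_comm, add_pow, Finset.sum_mul, show 2 * (m + 2) - 1 + 1 = 2 * (m + 2) by omega]
      refine Finset.sum_congr rfl fun i _ => ?_
      rw [smul_eq_C_mul, map_mul, map_pow, map_ofNat, map_natCast]
      ring
    rw [← e, derivative_pow, hdw, smul_eq_C_mul]
    simp only [map_mul, map_add, map_ofNat, map_natCast]
    push_cast
    ring
  have hc := congrArg (coeff m) hd
  rw [coeff_derivative, coeff_smul, smul_eq_mul, map_sum] at hc
  rw [mul_comm, hc]
  congr 1
  have hsub : Finset.range (m + 1) ⊆ Finset.range (2 * (m + 2)) :=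
    Finset.range_subset_range.mpr (by omega)
  rw [← Finset.sum_subset hsub]
  · refine Finset.sum_congr rfl fun i hi => ?_
    have hi' : i ≤ m := Nat.lt_succ_iff.mp (Finset.mem_range.mp hi)
    rw [coeff_smul, smul_eq_mul, coeff_X_pow_mul', if_pos hi', hv, mk_one_pow_eq_mk_choose_add,
      coeff_mk, show i + 1 + (m - i) = m + 1 by omega]
  · intro i _ hi
    rw [coeff_smul, coeff_X_pow_mul', if_neg (by simpa using hi), smul_zero]

theorem coeff_one_of_mul_one_sub_sq_eq {T : ℚ⟦X⟧} (h0 : constantCoeff T = 0)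
    (h : T * (1 - T) ^ 2 = X * (1 + T) ^ 2) : coeff 1 T = 1 := by
  obtain ⟨S, rfl⟩ := X_dvd_iff.mpr h0
  have hS : S * (1 - X * S) ^ 2 = (1 + X * S) ^ 2 := by
    apply mul_left_cancel₀ (X_ne_zero (R := ℚ))
    linear_combination h
  simpa [coeff_succ_X_mul] using congrArg constantCoeff hS

/-- The power series `T` with `T (1 - T)² = X (1 + T)²` has explicit coefficients. -/
theorem coeff_of_mul_one_sub_sq_eq {T : ℚ⟦X⟧} (h0 : constantCoeff T = 0)
    (h : T * (1 - T) ^ 2 = X * (1 + T) ^ 2) (m : ℕ) :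
    coeff (m + 2) T = 4 / (m + 1) * ∑ i ∈ Finset.range (m + 1),
      (2 : ℚ) ^ i * ((2 * (m + 2) - 1).choose i : ℚ) * ((m + 1).choose (i + 1) : ℚ) := by
  have h1 := coeff_one_of_mul_one_sub_sq_eq h0 h
  have : Invertible (coeff 1 T) := by rw [h1]; exact invertibleOne
  set g := substInv T
  have hg : constantCoeff g = 0 := constantCoeff_substInv _
  have hs : HasSubst g := HasSubst.of_constantCoeff_zero' hg
  have hTg : T.subst g = X := subst_substInv_right _ h0
  have hgX : X * (1 - X) ^ 2 = g * (1 + X) ^ 2 := by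
    have := congrArg (substAlgHom hs) h
    simp only [map_mul, map_pow, map_sub, map_add, map_one] at this
    rw [coe_substAlgHom, hTg, subst_X hs] at this
    exact this
  set w : ℚ⟦X⟧ := (1 + X) * mk 1 with hw
  have hw1 : w * (1 - X) = 1 + X := by
    rw [hw, mul_assoc, mk_one_mul_one_sub_eq_one, mul_one]
  have hgw : g * w ^ 2 = X := by
    have hv := mk_one_mul_one_sub_eq_one ℚ
    rw [hw, mul_pow, ← mul_assoc, ← hgX, mul_assoc, ← mul_pow, mul_comm (1 - X), hv, one_pow,
      mul_one]
  have hl := lagrange_inversion hg hgw hTg (m + 1)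
  have hc := coeff_one_add_div_one_sub_pow hw1 m
  rw [← pow_mul, show 2 * (m + 1 + 1) = 2 * (m + 2) by ring] at hl
  rw [← hl] at hc
  have hm1 : (m + 1 : ℚ) ≠ 0 := by positivity
  have hm2 : (m + 2 : ℚ) ≠ 0 := by positivity
  push_cast at hc
  rw [div_mul_eq_mul_div, eq_div_iff hm1]
  apply mul_left_cancel₀ hm2
  linear_combination hc

end PowerSeries

/-! ### Odd and even parts of the recurrences. -/

namespace PowerSeries

theorem evalNegHom_of_odd {f : ℚ⟦X⟧} (hf : ∀ n, Even n → coeff n f = 0) : evalNegHom f = -f := by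
  ext n
  rw [evalNegHom, coeff_rescale, map_neg]
  rcases n.even_or_odd with h | h
  · simp [hf n h]
  · simp [h.neg_one_pow]

theorem evalNegHom_of_even {f : ℚ⟦X⟧} (hf : ∀ n, Odd n → coeff n f = 0) : evalNegHom f = f := by
  ext n
  rw [evalNegHom, coeff_rescale]
  rcases n.even_or_odd with h | h
  · simp [h.neg_one_pow]
  · simp [hf n h]

/-- The parity-graded first-component recurrences determine the odd and even parts. -/
theorem parity_system {O T E F G H : ℚ⟦X⟧}
    (hO : evalNegHom O = -O) (hT : evalNegHom T = T)
    (hE : evalNegHom E = -E) (hF : evalNegHom F = -F)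
    (hG : evalNegHom G = G) (hH : evalNegHom H = H)
    (h0 : O + T = E + G + E * (O + T)) (h1 : O + T = F + H + H * (O + T))
    (h2 : E + G + (F + H) = O + T + X) :
    O - X = T * (O + X) ∧ T = O ^ 2 := by
  -- Adding and subtracting the image under X ↦ -X separates each equation into its even and odd
  -- parts.
  have k0 := congrArg evalNegHom h0
  have k1 := congrArg evalNegHom h1
  have k2 := congrArg evalNegHom h2
  simp only [map_add, map_mul, hO, hT, hE, hF, hG, hH, evalNegHom_X] at k0 k1 k2
  have two : (2 : ℚ⟦X⟧) ≠ 0 := fun h => by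
    have h' := congrArg constantCoeff h
    rw [map_ofNat, map_zero] at h'
    exact two_ne_zero h'
  have eO : O = E * (1 + T) := by
    apply mul_left_cancel₀ two; linear_combination h0 - k0
  have eG : T = G + E * O := by
    apply mul_left_cancel₀ two; linear_combination h0 + k0
  have eF : O = F + H * O := by
    apply mul_left_cancel₀ two; linear_combination h1 - k1
  have eH : T = H * (1 + T) := by
    apply mul_left_cancel₀ two; linear_combination h1 + k1
  have eEF : E + F = O + X := by
    apply mul_left_cancel₀ two; linear_combination h2 - k2
  have eGH : G + H = T := by
    apply mul_left_cancel₀ two; linear_combination h2 + k2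
  constructor
  · linear_combination eO + (1 + T) * eF + (1 + T) * eEF - O * eH
  · linear_combination eH + (1 + T) * eGH + (1 + T) * eG - O * eO

theorem expand_two_injective : Function.Injective (expand (R := ℚ) 2 two_ne_zero) := by
  intro f g h
  ext n
  have := congrArg (coeff (2 * n)) h
  simpa using this

end PowerSeries

open PowerSeries in
/-- The recurrences for the numbers `a n` of objects and for the numbers `i₀ n`, `i₁ n` of
indecomposable ones, translated into equations of power series. -/
theorem series_equations_of_recurrences {a i₀ i₁ : ℕ → ℚ}
    (h0 : ∀ n, 0 < n → a n = i₀ n + ∑ p ∈ Finset.HasAntidiagonal.antidiagonal n,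
      if 0 < p.1 ∧ 0 < p.2 ∧ Odd p.1 then i₀ p.1 * a p.2 else 0)
    (h1 : ∀ n, 0 < n → a n = i₁ n + ∑ p ∈ Finset.HasAntidiagonal.antidiagonal n,
      if 0 < p.1 ∧ 0 < p.2 ∧ Even p.1 then i₁ p.1 * a p.2 else 0)
    (h2 : ∀ n, 0 < n → i₀ n + i₁ n = a n + if n = 1 then 1 else 0)
    (ha : a 1 = 1) (R T : ℚ⟦X⟧) (hR : ∀ n, coeff n R = if n = 0 then 0 else a (2 * n + 1))
    (hT : ∀ n, coeff n T = if n = 0 then 0 else a (2 * n)) :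
    R = 2 * T + R * T ∧ T * (1 - T) ^ 2 = X * (1 + T) ^ 2 := by
  classical
  let od (f : ℕ → ℚ) : ℚ⟦X⟧ := mk fun n => if Odd n then f n else 0
  let ev (f : ℕ → ℚ) : ℚ⟦X⟧ := mk fun n => if 0 < n ∧ Even n then f n else 0
  have hod (f : ℕ → ℚ) : evalNegHom (od f) = -od f := evalNegHom_of_odd fun n hn => by
    simp [od, Nat.not_odd_iff_even.mpr hn]
  have hev (f : ℕ → ℚ) : evalNegHom (ev f) = ev f := evalNegHom_of_even fun n hn => by
    simp [ev, Nat.not_even_iff_odd.mpr hn]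
  have hsum (f : ℕ → ℚ) (n : ℕ) : coeff n (od f + ev f) = if 0 < n then f n else 0 := by
    rcases n.even_or_odd with h | h
    · simp [od, ev, h, Nat.not_odd_iff_even.mpr h]
    · simp [od, ev, h, Nat.not_even_iff_odd.mpr h, h.pos]
  obtain ⟨e1, e2⟩ := parity_system (hod a) (hev a) (hod i₀) (hod i₁) (hev i₀) (hev i₁)
    (by
      ext n
      rw [map_add _ (od i₀ + ev i₀), hsum, hsum, coeff_mul]
      rcases n.eq_zero_or_pos with rfl | hn
      · simp [od]
      · rw [if_pos hn, if_pos hn, h0 n hn]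
        congr 1
        refine Finset.sum_congr rfl fun p _ => ?_
        rw [hsum, coeff_mk]
        by_cases hp : Odd p.1 <;> by_cases hq : 0 < p.2 <;> simp [hp, hq, Odd.pos])
    (by
      ext n
      rw [map_add _ (od i₁ + ev i₁), hsum, hsum, coeff_mul]
      rcases n.eq_zero_or_pos with rfl | hn
      · simp [ev]
      · rw [if_pos hn, if_pos hn, h1 n hn]
        congr 1
        refine Finset.sum_congr rfl fun p _ => ?_
        rw [hsum, coeff_mk]
        by_cases hp : 0 < p.1 <;> by_cases hp' : Even p.1 <;> by_cases hq : 0 < p.2 <;>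
          simp [hp, hp', hq])
    (by
      ext n
      rw [map_add _ (od i₀ + ev i₀), map_add _ (od a + ev a), hsum, hsum, hsum, coeff_X]
      rcases n.eq_zero_or_pos with rfl | hn
      · simp
      · simp only [if_pos hn, h2 n hn])
  have hTe : ev a = expand 2 two_ne_zero T := by
    ext n
    rw [coeff_expand, coeff_mk]
    rcases n.even_or_odd' with ⟨m, rfl | rfl⟩
    · simp [hT, Nat.pos_iff_ne_zero, ite_not]
    · simp [← even_iff_two_dvd]
  -- The summand 1 is the permutation of length 1, which R omits.
  have hRo : od a = X * expand 2 two_ne_zero (1 + R) := by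
    ext n
    obtain _ | n := n
    · simp [od]
    rw [coeff_succ_X_mul, coeff_expand, coeff_mk]
    rcases n.even_or_odd' with ⟨m, rfl | rfl⟩
    · rcases m.eq_zero_or_pos with rfl | hm
      · have hR0 := hR 0
        simp only [coeff_zero_eq_constantCoeff, if_true] at hR0
        simp [hR0, ha]
      · simp [hR, hm.ne', coeff_one]
    · simp [← even_iff_two_dvd, Nat.even_add_one]
  rw [hTe, hRo] at e1 e2
  have hX : X ^ 2 = expand 2 two_ne_zero (X : ℚ⟦X⟧) := by rw [expand_X]
  have f1 : R = 2 * T + R * T := by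
    apply expand_two_injective
    apply mul_left_cancel₀ (X_ne_zero (R := ℚ))
    simp only [map_add, map_mul, map_one, map_ofNat] at e1 ⊢
    linear_combination e1
  have f2 : T = X * (1 + R) ^ 2 := by
    apply expand_two_injective
    rw [e2, mul_pow, hX, map_mul, map_pow]
  refine ⟨f1, ?_⟩
  have f3 : (1 + R) * (1 - T) = 1 + T := by linear_combination f1
  linear_combination (1 - T) ^ 2 * f2 + X * ((1 + R) * (1 - T) + (1 + T)) * f3

/-! ### Words avoiding 3142 and 2413 split. -/

/-- The word `v 0, …, v (n - 1)` has no subsequence order-isomorphic to `3142`. -/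
def Avoids3142 (n : ℕ) (v : ℕ → ℤ) : Prop :=
  ∀ a b c d, a < b → b < c → c < d → d < n → ¬ (v b < v d ∧ v d < v a ∧ v a < v c)

/-- The word `v 0, …, v (n - 1)` is the concatenation of two nonempty words, with every entry of
the first one below every entry of the second one. -/
def SplitsUp (n : ℕ) (v : ℕ → ℤ) : Prop :=
  ∃ k, 0 < k ∧ k < n ∧ ∀ i j, i < k → k ≤ j → j < n → v i < v j

/-- If the new last entry lies above the whole lower block, the old cut survives; if below it, the
last entry is split off downwards. Otherwise cut at the first b in the lower block with v b > v n: a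
later entry j of that block with v j < v n would make b, j, k, n a 3142. -/
theorem SplitsUp.succ_or {n : ℕ} {v : ℕ → ℤ} (hv : ∀ i < n, v i ≠ v n)
    (h : Avoids3142 (n + 1) v) (hs : SplitsUp n v) :
    SplitsUp (n + 1) v ∨ SplitsUp (n + 1) (-v) := by
  obtain ⟨k, hk0, hkn, hk⟩ := hs
  by_cases h1 : ∀ i < k, v i < v n
  · refine .inl ⟨k, hk0, by omega, fun i j hi hj hjn => ?_⟩
    rcases Nat.lt_succ_iff_lt_or_eq.mp hjn with hj' | rfl
    · exact hk i j hi hj hj'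
    · exact h1 i hi
  by_cases h2 : ∀ i < k, v n < v i
  · refine .inr ⟨n, by omega, by omega, fun i j hi hj hjn => ?_⟩
    obtain rfl : j = n := by omega
    simp only [Pi.neg_apply, neg_lt_neg_iff]
    rcases lt_or_ge i k with hik | hik
    · exact h2 i hik
    · exact (h2 0 hk0).trans (hk 0 i hk0 hik hi)
  push Not at h1 h2
  obtain ⟨a, hak, ha⟩ := h2
  replace ha : v a < v n := lt_of_le_of_ne ha (hv a (by omega))
  classical
  let b := Nat.find h1
  obtain ⟨hbk, hb⟩ : b < k ∧ v n ≤ v b := Nat.find_spec h1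
  replace hb : v n < v b := lt_of_le_of_ne hb (hv b (by omega)).symm
  have hlt : ∀ i < b, v i < v n := fun i hi => by
    by_contra hc
    exact Nat.find_min h1 hi ⟨by omega, not_lt.mp hc⟩
  have hgt : ∀ j, b ≤ j → j < k → v n < v j := fun j hbj hj => by
    rcases hbj.eq_or_lt with rfl | hbj
    · exact hb
    refine lt_of_le_of_ne (not_lt.mp fun hc => ?_) (hv j (by omega)).symm
    exact h b j k n hbj hj hkn (by omega) ⟨hc, hb, hk b k hbk le_rfl hkn⟩
  have hab : a < b := by
    by_contra hc
    exact absurd (hgt a (by omega) hak) ha.not_gt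
  refine .inl ⟨b, by omega, by omega, fun i j hi hj hjn => ?_⟩
  rcases Nat.lt_succ_iff_lt_or_eq.mp hjn with hj' | rfl
  · rcases lt_or_ge j k with hjk | hjk
    · exact (hlt i hi).trans (hgt j hj hjk)
    · exact hk i j (by omega) hjk hj'
  · exact hlt i hi

/-- A word with distinct entries that avoids `3142` and `2413` splits up or down. -/
theorem splitsUp_or_splitsUp_neg {v : ℕ → ℤ} {n : ℕ} (hv : ∀ j < n + 2, ∀ i < j, v i ≠ v j)
    (h : Avoids3142 (n + 2) v) (h' : Avoids3142 (n + 2) (-v)) :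
    SplitsUp (n + 2) v ∨ SplitsUp (n + 2) (-v) := by
  induction n with
  | zero =>
    have aux (w : ℕ → ℤ) (hw : w 0 < w 1) : SplitsUp 2 w := by
      refine ⟨1, by omega, by omega, fun i j hi hj hj2 => ?_⟩
      obtain rfl : i = 0 := by omega
      obtain rfl : j = 1 := by omega
      exact hw
    rcases (hv 1 (by omega) 0 (by omega)).lt_or_gt with hlt | hlt
    · exact .inl (aux v hlt)
    · exact .inr (aux (-v) (neg_lt_neg hlt))
  | succ n ih =>
    have hmono {w : ℕ → ℤ} (hw : Avoids3142 (n + 3) w) : Avoids3142 (n + 2) w :=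
      fun a b c d hab hbc hcd hd => hw a b c d hab hbc hcd (by omega)
    rcases ih (fun j hj => hv j (by omega)) (hmono h) (hmono h') with hs | hs
    · exact hs.succ_or (hv (n + 2) (by omega)) h
    · have := hs.succ_or (fun i hi => by simpa using hv (n + 2) (by omega) i hi) h'
      rwa [neg_neg, or_comm] at this

/-- A word with at least two entries does not split both up and down. -/
theorem SplitsUp.not_neg {n : ℕ} {v : ℕ → ℤ} (h : SplitsUp n v) : ¬ SplitsUp n (-v) := by
  rintro ⟨l, hl0, hln, hl⟩
  obtain ⟨k, hk0, hkn, hk⟩ := h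
  have h1 := hk 0 (n - 1) hk0 (by omega) (by omega)
  have h2 := hl 0 (n - 1) hl0 (by omega) (by omega)
  simp only [Pi.neg_apply, neg_lt_neg_iff] at h2
  exact h1.not_gt h2

/-! ### Alternating permutations with either first step. -/

open Equiv

/-- A permutation whose word alternates, with the step from `i` to `i + 1` going up iff `c + i` is
even. -/
def AlternatesFrom (c : ℕ) {n : ℕ} (π : Perm (Fin n)) : Prop :=
  ∀ i j : Fin n, (j : ℕ) = (i : ℕ) + 1 →
    (Even (c + (i : ℕ)) → π i < π j) ∧ (Odd (c + (i : ℕ)) → π j < π i)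

/-- Permutations alternating from the parity of `c` on and avoiding `2413` and `3142`. -/
def separableAlternatingFrom (c n : ℕ) : Set (Perm (Fin n)) :=
  {π | AlternatesFrom c π ∧ ¬ ContainsPattern π pattern2413 ∧ ¬ ContainsPattern π pattern3142}

theorem separableAlternatingFrom_zero (n : ℕ) :
    separableAlternatingFrom 0 n = separableAlternating n := by
  simp [separableAlternatingFrom, separableAlternating, AlternatesFrom, IsAlternatingPerm]

/-- The permutation is a direct sum of a permutation of length `k` and another one. -/
def IsSplitAt (k : ℕ) {n : ℕ} (π : Perm (Fin n)) : Prop :=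
  0 < k ∧ k < n ∧ ∀ i j : Fin n, (i : ℕ) < k → k ≤ (j : ℕ) → π i < π j

/-- The elements of `separableAlternatingFrom c n` that are not direct sums. -/
def indecomposableFrom (c n : ℕ) : Set (Perm (Fin n)) :=
  {π | π ∈ separableAlternatingFrom c n ∧ ∀ k, ¬ IsSplitAt k π}

/-! ### Complementation. -/

section Complement

variable {n : ℕ}

/-- Turning the diagram of a permutation upside down. -/
def Equiv.Perm.complement (π : Perm (Fin n)) : Perm (Fin n) := Fin.revPerm * π

theorem complement_lt_iff (π : Perm (Fin n)) (i j : Fin n) :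
    π.complement i < π.complement j ↔ π j < π i := by
  simp [Perm.complement]

theorem complement_complement (π : Perm (Fin n)) : π.complement.complement = π := by
  ext i; simp [Perm.complement]

theorem complement_injective : Function.Injective (Perm.complement (n := n)) :=
  Function.LeftInverse.injective complement_complement

theorem alternatesFrom_complement {c : ℕ} {π : Perm (Fin n)} :
    AlternatesFrom c π.complement ↔ AlternatesFrom (c + 1) π := by
  unfold AlternatesFrom
  refine forall₃_congr fun i j _ => ?_
  rw [complement_lt_iff, complement_lt_iff, add_right_comm, Nat.even_add_one, Nat.odd_add_one,
    Nat.not_even_iff_odd, Nat.not_odd_iff_even, and_comm]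

theorem containsPattern_complement {k : ℕ} {π : Perm (Fin n)} {p q : Perm (Fin k)}
    (h : p.complement = q) : ContainsPattern π.complement p ↔ ContainsPattern π q := by
  subst h
  simp only [ContainsPattern, complement_lt_iff]
  exact exists_congr fun f => and_congr_right fun _ => ⟨fun h a b => h b a, fun h a b => h b a⟩

theorem complement_pattern2413 : pattern2413.complement = pattern3142 := by decide

theorem complement_pattern3142 : pattern3142.complement = pattern2413 := by decide

theorem complement_mem_separableAlternatingFrom {c : ℕ} {π : Perm (Fin n)} :
    π.complement ∈ separableAlternatingFrom c n ↔ π ∈ separableAlternatingFrom (c + 1) n := by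
  simp only [separableAlternatingFrom, Set.mem_ofPred_eq, alternatesFrom_complement,
    containsPattern_complement complement_pattern2413,
    containsPattern_complement complement_pattern3142]
  tauto

/-- Complementation reverses every step and swaps the two patterns, so the first step does not
affect the count. -/
theorem ncard_separableAlternatingFrom (c n : ℕ) :
    (separableAlternatingFrom c n).ncard = (separableAlternating n).ncard := by
  induction c with
  | zero => rw [separableAlternatingFrom_zero]
  | succ c ih =>
    rw [← ih, ← Set.ncard_image_of_injective _ complement_injective]
    congr 1
    ext π
    constructor
    · rintro ⟨σ, hσ, rfl⟩
      exact complement_mem_separableAlternatingFrom.mpr hσ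
    · intro hπ
      refine ⟨π.complement, ?_, complement_complement π⟩
      rwa [← complement_mem_separableAlternatingFrom, complement_complement]

end Complement

/-! ### Direct sum or complement of one. -/

section Dichotomy

variable {n : ℕ} {π : Perm (Fin n)} {w : ℕ → ℤ}

theorem splitsUp_iff (hw : ∀ i j : Fin n, w i < w j ↔ π i < π j) :
    SplitsUp n w ↔ ∃ k, IsSplitAt k π := by
  refine exists_congr fun k => and_congr_right fun _ => and_congr_right fun hk => ?_
  constructor
  · exact fun h i j hi hj => (hw i j).mp (h i j hi hj j.2)
  · exact fun h i j hi hj hjn => (hw ⟨i, by omega⟩ ⟨j, hjn⟩).mpr (h _ _ hi hj)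

theorem avoids3142_of_not_containsPattern (hw : ∀ i j : Fin n, w i < w j ↔ π i < π j)
    (h : ¬ ContainsPattern π pattern3142) : Avoids3142 n w := by
  rintro a b c d hab hbc hcd hd ⟨h1, h2, h3⟩
  let f : Fin 4 → Fin n := ![⟨a, by omega⟩, ⟨b, by omega⟩, ⟨c, by omega⟩, ⟨d, hd⟩]
  refine h ⟨f, ?_, ?_⟩
  · rw [Fin.strictMono_iff_lt_succ]
    intro i
    fin_cases i
    · exact hab
    · exact hbc
    · exact hcd
  · intro x y
    rw [← hw]
    fin_cases x <;> fin_cases y <;> simp [f, pattern3142] <;> omega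

/-- A separable permutation of length at least two is either a direct sum or the complement of
one, but not both. -/
theorem isSplitAt_xor_complement (hn : 2 ≤ n) (h : ¬ ContainsPattern π pattern2413)
    (h' : ¬ ContainsPattern π pattern3142) :
    (∃ k, IsSplitAt k π.complement) ↔ ¬ ∃ k, IsSplitAt k π := by
  let w : ℕ → ℤ := fun i => if hi : i < n then ((π ⟨i, hi⟩ : ℕ) : ℤ) else 0
  have hw : ∀ i j : Fin n, w i < w j ↔ π i < π j := fun i j => by simp [w]
  have hw' : ∀ i j : Fin n, (-w) i < (-w) j ↔ π.complement i < π.complement j := fun i j => by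
    rw [complement_lt_iff, ← hw, Pi.neg_apply, Pi.neg_apply, neg_lt_neg_iff]
  rw [← splitsUp_iff hw, ← splitsUp_iff hw']
  have hc := (containsPattern_complement (π := π) complement_pattern3142).not.mpr h
  obtain ⟨n, rfl⟩ := Nat.exists_eq_add_of_le' hn
  have := splitsUp_or_splitsUp_neg (fun j hj i hij => by
      simp only [w, hj, hij.trans hj, dif_pos]
      simp [Fin.val_inj, hij.ne])
    (avoids3142_of_not_containsPattern hw h') (avoids3142_of_not_containsPattern hw' hc)
  exact ⟨fun h1 h2 => h2.not_neg h1, this.resolve_left⟩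

/-- For n ≥ 2, complementation carries the indecomposables counted by the second term onto the
decomposables missed by the first. The permutation of length 1 is indecomposable for both parities,
hence counted twice. -/
theorem ncard_indecomposableFrom_add {n : ℕ} (hn : 0 < n) :
    (indecomposableFrom 0 n).ncard + (indecomposableFrom 1 n).ncard
      = (separableAlternating n).ncard + if n = 1 then 1 else 0 := by
  rcases (show 1 ≤ n from hn).eq_or_lt with rfl | hn
  · have huniv (s : Set (Perm (Fin 1))) (hs : 1 ∈ s) : s.ncard = 1 := by
      rw [Set.eq_univ_of_forall (s := s) fun π => by rwa [Subsingleton.elim π 1]]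
      simp [Set.ncard_univ]
    have hmem (c : ℕ) : 1 ∈ separableAlternatingFrom c 1 := by
      have hp (p : Perm (Fin 4)) : ¬ ContainsPattern (1 : Perm (Fin 1)) p := by
        rintro ⟨f, hf, -⟩
        have : f 0 < f 1 := hf (by decide)
        omega
      exact ⟨fun i j hij => by omega, hp _, hp _⟩
    have hind (c : ℕ) : 1 ∈ indecomposableFrom c 1 :=
      ⟨hmem c, fun k hk => by have := hk.1; have := hk.2.1; omega⟩
    rw [huniv _ (hind 0), huniv _ (hind 1), ← separableAlternatingFrom_zero, huniv _ (hmem 0),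
      if_pos rfl]
  · rw [if_neg (by omega), add_zero, ← separableAlternatingFrom_zero,
      ← Set.ncard_image_of_injective (indecomposableFrom 1 n) complement_injective,
      ← Set.ncard_union_eq]
    · congr 1
      ext π
      simp only [Set.mem_union, Set.mem_image]
      constructor
      · rintro (h | ⟨σ, h, rfl⟩)
        · exact h.1
        · exact complement_mem_separableAlternatingFrom.mpr h.1
      · intro h
        by_cases hs : ∃ k, IsSplitAt k π
        · refine .inr ⟨π.complement, ⟨?_, ?_⟩, complement_complement π⟩
          · rwa [← complement_mem_separableAlternatingFrom, complement_complement]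
          · have := (isSplitAt_xor_complement hn h.2.1 h.2.2).not_left.mpr hs
            exact not_exists.mp this
        · exact .inl ⟨h, not_exists.mp hs⟩
    · rw [Set.disjoint_left]
      rintro _ h ⟨σ, h', rfl⟩
      have hσ := h'.1
      have := (isSplitAt_xor_complement hn hσ.2.1 hσ.2.2).mpr (not_exists.mpr h'.2)
      exact not_exists.mpr h.2 this

end Dichotomy

/-! ### Direct sums, alternation and patterns. -/

section DirectSum

variable {k l : ℕ}

/-- The direct sum of two permutations: the second one is placed above and to the right of the
first one. -/
def Equiv.Perm.directSum (α : Perm (Fin k)) (β : Perm (Fin l)) : Perm (Fin (k + l)) :=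
  finSumFinEquiv.permCongr (Perm.sumCongr α β)

theorem directSum_castAdd (α : Perm (Fin k)) (β : Perm (Fin l)) (i : Fin k) :
    α.directSum β (Fin.castAdd l i) = Fin.castAdd l (α i) := by
  simp [Perm.directSum]

theorem directSum_natAdd (α : Perm (Fin k)) (β : Perm (Fin l)) (i : Fin l) :
    α.directSum β (Fin.natAdd k i) = Fin.natAdd k (β i) := by
  simp [Perm.directSum]

theorem directSum_injective :
    Function.Injective fun p : Perm (Fin k) × Perm (Fin l) => p.1.directSum p.2 := by
  intro p q h
  exact Perm.sumCongrHom_injective (finSumFinEquiv.permCongr.injective h)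

theorem IsSplitAt.exists_directSum {π : Perm (Fin (k + l))} (h : IsSplitAt k π) :
    ∃ (α : Perm (Fin k)) (β : Perm (Fin l)), α.directSum β = π := by
  -- A value in the first k positions has all l values of the later positions above it, so it is
  -- less than k.
  have hmaps : ∀ i : Fin k, (π (Fin.castAdd l i) : ℕ) < k := fun i => by
    have hle : (Finset.univ.map (Fin.natAddEmb k : Fin l ↪ Fin (k + l))).map π.toEmbedding
        ⊆ Finset.Ioi (π (Fin.castAdd l i)) := by
      intro x hx
      simp only [Finset.mem_map, Finset.mem_univ, true_and] at hx
      obtain ⟨_, ⟨j, rfl⟩, rfl⟩ := hx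
      exact Finset.mem_Ioi.mpr (h.2.2 _ _ (by simp) (by simp))
    have := Finset.card_le_card hle
    rw [Finset.card_map, Finset.card_map, Finset.card_univ, Fintype.card_fin, Fin.card_Ioi] at this
    omega
  obtain ⟨⟨α, β⟩, hαβ⟩ := Perm.mem_sumCongrHom_range_of_perm_mapsTo_inl
    (σ := finSumFinEquiv.symm.permCongr π) (by
      rintro _ ⟨i, rfl⟩
      refine ⟨⟨π (Fin.castAdd l i), hmaps i⟩, ?_⟩
      rw [Equiv.permCongr_apply, Equiv.symm_symm, finSumFinEquiv_apply_left, Equiv.eq_symm_apply,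
        finSumFinEquiv_apply_left]
      rfl)
  refine ⟨α, β, ?_⟩
  rw [Perm.directSum]
  have h2 : Perm.sumCongr α β = finSumFinEquiv.symm.permCongr π := hαβ
  rw [h2]
  ext i
  simp

theorem directSum_castAdd_lt_natAdd (α : Perm (Fin k)) (β : Perm (Fin l)) (i : Fin k) (j : Fin l) :
    α.directSum β (Fin.castAdd l i) < α.directSum β (Fin.natAdd k j) := by
  rw [directSum_castAdd, directSum_natAdd, Fin.lt_def]
  simp only [Fin.val_castAdd, Fin.val_natAdd]
  omega

theorem isSplitAt_directSum (hk : 0 < k) (hl : 0 < l) (α : Perm (Fin k)) (β : Perm (Fin l)) :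
    IsSplitAt k (α.directSum β) := by
  refine ⟨hk, by omega, fun i j hi hj => ?_⟩
  induction i using Fin.addCases with
  | right i => simp at hi
  | left i =>
    induction j using Fin.addCases with
    | left j => simp at hj; omega
    | right j => exact directSum_castAdd_lt_natAdd α β i j

theorem isSplitAt_directSum_iff {m : ℕ} (hm : m < k) (α : Perm (Fin k)) (β : Perm (Fin l)) :
    IsSplitAt m (α.directSum β) ↔ IsSplitAt m α := by
  refine and_congr_right fun _ => ⟨fun h => ⟨hm, fun i j hi hj => ?_⟩,
    fun h => ⟨by omega, fun i j hi hj => ?_⟩⟩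
  · have := h.2 (Fin.castAdd l i) (Fin.castAdd l j) hi hj
    rwa [directSum_castAdd, directSum_castAdd] at this
  · induction i using Fin.addCases with
    | right i => simp at hi; omega
    | left i =>
      induction j using Fin.addCases with
      | left j =>
        rw [directSum_castAdd, directSum_castAdd]
        exact h.2 i j hi hj
      | right j => exact directSum_castAdd_lt_natAdd α β i j

/-- The step from position k - 1 to k always ascends, so c + k - 1 must be even. -/
theorem alternatesFrom_directSum {c : ℕ} (hk : 0 < k) (hl : 0 < l) {α : Perm (Fin k)}
    {β : Perm (Fin l)} : AlternatesFrom c (α.directSum β) ↔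
      Odd (c + k) ∧ AlternatesFrom c α ∧ AlternatesFrom (c + k) β := by
  constructor
  · intro h
    refine ⟨?_, fun i j hij => ?_, fun i j hij => ?_⟩
    · by_contra hc
      have h1 := (h (Fin.castAdd l ⟨k - 1, by omega⟩) (Fin.natAdd k ⟨0, hl⟩)
        (by simp only [Fin.val_castAdd, Fin.val_natAdd]; omega)).2
        (by
          rw [Nat.not_odd_iff_even] at hc
          rw [← Nat.not_even_iff_odd]
          simp only [Fin.val_castAdd]
          intro hc'
          rw [show c + k = c + (k - 1) + 1 by omega, Nat.even_add_one] at hc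
          exact hc hc')
      exact h1.not_gt (directSum_castAdd_lt_natAdd α β _ _)
    · have := h (Fin.castAdd l i) (Fin.castAdd l j) hij
      rwa [directSum_castAdd, directSum_castAdd] at this
    · have := h (Fin.natAdd k i) (Fin.natAdd k j)
        (by simp only [Fin.val_natAdd]; omega)
      rw [directSum_natAdd, directSum_natAdd, Fin.val_natAdd, ← add_assoc] at this
      simpa using this
  · rintro ⟨hodd, hα, hβ⟩ i j hij
    induction i using Fin.addCases with
    | left i =>
      induction j using Fin.addCases with
      | left j =>
        rw [directSum_castAdd, directSum_castAdd]
        exact hα i j hij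
      | right j =>
        refine ⟨fun _ => directSum_castAdd_lt_natAdd α β i j, fun h => ?_⟩
        simp only [Fin.val_castAdd, Fin.val_natAdd] at hij h
        rw [show c + k = c + i + 1 by omega, Nat.odd_add_one] at hodd
        exact absurd h hodd
    | right i =>
      induction j using Fin.addCases with
      | left j => simp only [Fin.val_castAdd, Fin.val_natAdd] at hij; omega
      | right j =>
        simp only [Fin.val_natAdd] at hij
        rw [directSum_natAdd, directSum_natAdd, Fin.val_natAdd, ← add_assoc]
        simpa using hβ i j (by omega)

/-- The hypothesis says that p is not itself a direct sum. An occurrence meeting both summands would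
split p at the first index y sent into the second one. -/
theorem containsPattern_directSum {m : ℕ} {p : Perm (Fin m)}
    (hp : ∀ s, 0 < s → s < m → ∃ i j : Fin m, (i : ℕ) < s ∧ s ≤ (j : ℕ) ∧ p j < p i)
    {α : Perm (Fin k)} {β : Perm (Fin l)} :
    ContainsPattern (α.directSum β) p ↔ ContainsPattern α p ∨ ContainsPattern β p := by
  constructor
  · rintro ⟨f, hf, hfp⟩
    by_cases hright : ∀ a, k ≤ (f a : ℕ)
    · right
      have hg (a : Fin m) : f a = Fin.natAdd k ⟨f a - k, by have := hright a; omega⟩ := by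
        ext; simp [hright a]
      refine ⟨fun a => ⟨f a - k, by have := hright a; omega⟩, fun a b hab => ?_, fun a b => ?_⟩
      · have h1 := hright a
        have h2 : (f a : ℕ) < f b := hf hab
        simp only [Fin.lt_def]
        omega
      · rw [← hfp, hg a, hg b, directSum_natAdd, directSum_natAdd]
        simp
    by_cases hleft : ∀ a, (f a : ℕ) < k
    · left
      have hg (a : Fin m) : f a = Fin.castAdd l ⟨f a, hleft a⟩ := rfl
      refine ⟨fun a => ⟨f a, hleft a⟩, fun a b hab => hf hab, fun a b => ?_⟩
      rw [← hfp, hg a, hg b, directSum_castAdd, directSum_castAdd]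
      rfl
    push Not at hright hleft
    obtain ⟨x, hx⟩ := hright
    classical
    have hex : ∃ s : ℕ, ∃ y : Fin m, (y : ℕ) = s ∧ k ≤ (f y : ℕ) := by
      obtain ⟨y, hy⟩ := hleft
      exact ⟨y, y, rfl, hy⟩
    obtain ⟨y, hy, hky⟩ := Nat.find_spec hex
    have hlt : ∀ i : Fin m, (i : ℕ) < y → (f i : ℕ) < k := fun i hi => by
      by_contra hc
      exact Nat.find_min hex (hy ▸ hi) ⟨i, rfl, not_lt.mp hc⟩
    have hge : ∀ j : Fin m, (y : ℕ) ≤ j → k ≤ (f j : ℕ) := fun j hj =>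
      hky.trans (hf.monotone hj)
    have hxy : (x : ℕ) < y := by
      by_contra hc
      exact absurd (hge x (not_lt.mp hc)) hx.not_ge
    obtain ⟨i, j, hi, hj, hij⟩ := hp y (by omega) y.2
    rw [← hfp] at hij
    have h1 := hlt i hi
    have h2 := hge j hj
    have hs := (isSplitAt_directSum (l := l) (by omega) (by have := (f j).2; omega) α β).2.2
      (f i) (f j) h1 h2
    exact absurd hij hs.not_gt
  · rintro (⟨f, hf, hfp⟩ | ⟨f, hf, hfp⟩)
    · refine ⟨fun a => Fin.castAdd l (f a), fun a b hab => hf hab, fun a b => ?_⟩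
      rw [directSum_castAdd, directSum_castAdd, ← hfp]
      rfl
    · refine ⟨fun a => Fin.natAdd k (f a), fun a b hab => ?_, fun a b => ?_⟩
      · simpa using hf hab
      · rw [directSum_natAdd, directSum_natAdd, ← hfp]
        simp

theorem directSum_mem_separableAlternatingFrom {c : ℕ} (hk : 0 < k) (hl : 0 < l)
    {α : Perm (Fin k)} {β : Perm (Fin l)} :
    α.directSum β ∈ separableAlternatingFrom c (k + l) ↔ Odd (c + k) ∧
      α ∈ separableAlternatingFrom c k ∧ β ∈ separableAlternatingFrom (c + k) l := by
  have h1 : ∀ s, 0 < s → s < 4 → ∃ i j : Fin 4, (i : ℕ) < s ∧ s ≤ (j : ℕ) ∧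
      pattern2413 j < pattern2413 i := by
    intro s hs hs'; interval_cases s <;> decide
  have h2 : ∀ s, 0 < s → s < 4 → ∃ i j : Fin 4, (i : ℕ) < s ∧ s ≤ (j : ℕ) ∧
      pattern3142 j < pattern3142 i := by
    intro s hs hs'; interval_cases s <;> decide
  simp only [separableAlternatingFrom, Set.mem_ofPred_eq, alternatesFrom_directSum hk hl,
    containsPattern_directSum h1, containsPattern_directSum h2]
  tauto

end DirectSum

/-! ### Counting by the first component. -/

section Count

/-- The length of the first component of a direct sum, and `0` for other permutations. -/
noncomputable def firstSplit {n : ℕ} (π : Perm (Fin n)) : ℕ := sInf {k | IsSplitAt k π}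

theorem firstSplit_eq_zero_iff {n : ℕ} {π : Perm (Fin n)} :
    firstSplit π = 0 ↔ ∀ k, ¬ IsSplitAt k π := by
  rw [firstSplit, Nat.sInf_eq_zero, or_iff_right fun h => lt_irrefl 0 h.1,
    Set.eq_empty_iff_forall_notMem]
  rfl

theorem firstSplit_eq_iff {n k : ℕ} (hk : 0 < k) {π : Perm (Fin n)} :
    firstSplit π = k ↔ IsSplitAt k π ∧ ∀ j < k, ¬ IsSplitAt j π := by
  constructor
  · rintro rfl
    exact ⟨Nat.sInf_mem (Nat.nonempty_of_pos_sInf hk), fun j hj => Nat.notMem_of_lt_sInf hj⟩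
  · rintro ⟨h, hmin⟩
    refine le_antisymm (Nat.sInf_le h) (not_lt.mp fun hc => ?_)
    exact hmin _ hc (Nat.sInf_mem (s := {k | IsSplitAt k π}) ⟨k, h⟩)

theorem firstSplit_le {n : ℕ} (π : Perm (Fin n)) : firstSplit π ≤ n := by
  rcases Nat.eq_zero_or_pos (firstSplit π) with h | h
  · omega
  · exact ((firstSplit_eq_iff h).mp rfl).1.2.1.le

/-- Cutting at the least split point is a bijection onto pairs: the first part is indecomposable
because its splits are splits of the whole, and the second part is unrestricted apart from its
starting parity. -/
theorem ncard_firstSplit_eq (c : ℕ) {k : ℕ} (hk : 0 < k) (l : ℕ) :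
    {π ∈ separableAlternatingFrom c (k + l) | firstSplit π = k}.ncard =
      if 0 < l ∧ Odd (c + k) then
        (indecomposableFrom c k).ncard * (separableAlternating l).ncard else 0 := by
  split_ifs with h
  · rw [← ncard_separableAlternatingFrom (c + k), ← Set.ncard_prod,
      ← Set.ncard_image_of_injective _ directSum_injective]
    congr 1
    ext π
    simp only [Set.mem_image, Set.mem_prod, Prod.exists, Set.mem_ofPred_eq, firstSplit_eq_iff hk]
    constructor
    · rintro ⟨hπ, hs, hmin⟩
      obtain ⟨α, β, rfl⟩ := hs.exists_directSum
      obtain ⟨-, hα, hβ⟩ := (directSum_mem_separableAlternatingFrom hk h.1).mp hπ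
      refine ⟨α, β, ⟨⟨hα, fun j hj => ?_⟩, hβ⟩, rfl⟩
      exact hmin j hj.2.1 ((isSplitAt_directSum_iff hj.2.1 α β).mpr hj)
    · rintro ⟨α, β, ⟨⟨hα, hα'⟩, hβ⟩, rfl⟩
      refine ⟨(directSum_mem_separableAlternatingFrom hk h.1).mpr ⟨h.2, hα, hβ⟩,
        isSplitAt_directSum hk h.1 α β, fun j hj hs => ?_⟩
      exact hα' j ((isSplitAt_directSum_iff hj α β).mp hs)
  · rw [Set.ncard_eq_zero, Set.eq_empty_iff_forall_notMem]
    rintro π ⟨hπ, hs⟩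
    have hs := ((firstSplit_eq_iff hk).mp hs).1
    have hl : 0 < l := by have := hs.2.1; omega
    obtain ⟨α, β, rfl⟩ := hs.exists_directSum
    exact h ⟨hl, ((directSum_mem_separableAlternatingFrom hk hl).mp hπ).1⟩

/-- Counting separable alternating permutations by their first component. -/
theorem ncard_separableAlternating_eq (c n : ℕ) :
    (separableAlternating n).ncard = (indecomposableFrom c n).ncard +
      ∑ p ∈ Finset.HasAntidiagonal.antidiagonal n, if 0 < p.1 ∧ 0 < p.2 ∧ Odd (c + p.1) then
        (indecomposableFrom c p.1).ncard * (separableAlternating p.2).ncard else 0 := by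
  classical
  have hfib : (separableAlternatingFrom c n).ncard = ∑ k ∈ Finset.range (n + 1),
      {π ∈ separableAlternatingFrom c n | firstSplit π = k}.ncard := by
    rw [Set.ncard_eq_toFinset_card', Finset.card_eq_sum_card_fiberwise (f := firstSplit)
      (t := Finset.range (n + 1))
      fun π _ => Finset.mem_coe.mpr (Finset.mem_range_succ_iff.mpr (firstSplit_le π))]
    refine Finset.sum_congr rfl fun k _ => ?_
    rw [← Set.ncard_coe_finset]
    congr 1
    ext π
    simp
  -- The fibre over 0 consists of the indecomposables, while the term k = 0 of the convolution
  -- vanishes.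
  rw [← ncard_separableAlternatingFrom c, hfib, Finset.sum_range_succ',
    add_comm, Finset.Nat.sum_antidiagonal_eq_sum_range_succ_mk, Finset.sum_range_succ' _ n]
  simp only [firstSplit_eq_zero_iff, lt_irrefl, false_and, if_false, add_zero]
  congr 1
  refine Finset.sum_congr rfl fun k hk => ?_
  obtain ⟨l, rfl⟩ := Nat.exists_eq_add_of_le (Nat.succ_le_of_lt (Finset.mem_range.mp hk))
  rw [Nat.succ_eq_add_one, ncard_firstSplit_eq c k.succ_pos l, Nat.add_sub_cancel_left]
  simp

end Count

/-! ### The functional equation and the formula. -/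

theorem mainTheorem9 :
    ((1 / 2 : ℚ) • seriesR = ((1 / 2 : ℚ) • seriesR) * seriesT + seriesT) ∧
    tCount 1 = 1 ∧
    ∀ n : ℕ, 2 ≤ n →
      (tCount n : ℚ) = 4 / ((n : ℚ) - 1) *
        ∑ i ∈ Finset.range (n - 1),
          (2 : ℚ) ^ i * ((2 * n - 1).choose i : ℚ) * ((n - 1).choose (i + 1) : ℚ) := by
  -- At length 1 the convolutions vanish, so a = i₀ = i₁, and i₀ + i₁ = a + 1 forces a = 1.
  have ha1 : (separableAlternating 1).ncard = 1 := by
    have h := ncard_indecomposableFrom_add one_pos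
    have h0 := ncard_separableAlternating_eq 0 1
    have h1 := ncard_separableAlternating_eq 1 1
    rw [Finset.sum_eq_zero, add_zero] at h0 h1
    · rw [← h0, ← h1, if_pos rfl] at h
      omega
    all_goals
      intro p hp
      rw [Finset.HasAntidiagonal.mem_antidiagonal] at hp
      exact if_neg (by omega)
  obtain ⟨hR, hT⟩ := series_equations_of_recurrences
    (a := fun n => ((separableAlternating n).ncard : ℚ))
    (i₀ := fun n => ((indecomposableFrom 0 n).ncard : ℚ))
    (i₁ := fun n => ((indecomposableFrom 1 n).ncard : ℚ))
    (fun n _ => by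
      have h := ncard_separableAlternating_eq 0 n
      simp only [zero_add] at h
      exact_mod_cast h)
    (fun n _ => by
      have h := ncard_separableAlternating_eq 1 n
      simp only [add_comm 1, Nat.odd_add_one, Nat.not_odd_iff_even] at h
      exact_mod_cast h)
    (fun n hn => by exact_mod_cast ncard_indecomposableFrom_add hn)
    (by exact_mod_cast ha1) seriesR seriesT
    (fun n => by simp [seriesR, rCount]) (fun n => by simp [seriesT, tCount])
  have hT0 : PowerSeries.constantCoeff seriesT = 0 := by
    rw [← PowerSeries.coeff_zero_eq_constantCoeff_apply]
    simp only [seriesT, PowerSeries.coeff_mk, if_true]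
  have hcoeff (n : ℕ) (hn : n ≠ 0) : (tCount n : ℚ) = PowerSeries.coeff n seriesT := by
    simp [seriesT, hn]
  refine ⟨?_, ?_, fun n hn => ?_⟩
  · have h2 : seriesT = (1 / 2 : ℚ) • (2 * seriesT) := by
      rw [← map_ofNat PowerSeries.C, ← PowerSeries.smul_eq_C_mul, smul_smul]
      norm_num
    conv_lhs => rw [hR]
    conv_rhs => rw [smul_mul_assoc, add_comm]; enter [1]; rw [h2]
    rw [smul_add]
  · have := hcoeff 1 one_ne_zero
    rw [PowerSeries.coeff_one_of_mul_one_sub_sq_eq hT0 hT] at this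
    exact_mod_cast this
  · obtain ⟨m, rfl⟩ := Nat.exists_eq_add_of_le' hn
    rw [hcoeff _ (by omega), PowerSeries.coeff_of_mul_one_sub_sq_eq hT0 hT m,
      show m + 2 - 1 = m + 1 from rfl]
    congr 2
    push_cast
    ring
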